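/- For $n\ge 0$ let $GM_n$ be the set of Grand Motzkin paths of length $n$, i.e. lattice paths with $n$ steps, each equal to $U=(1,1)$, $D=(1,-1)$ or $H=(1,0)$, starting at the origin and ending on the $x$-axis, partially ordered by $\gamma_1\le\gamma_2$ if and only if $\gamma_1$ lies weakly below $\gamma_2$ (the $n$-th Grand Motzkin lattice). For a finite poset $P$ let $\ell(P)$ be the number of edges of its Hasse diagram (the number of pairs $(x,y)$ such that $y$ covers $x$), and let $i(P)=\ell(P)/|P|$ be its Hasse index. Let $\binom{n;\,3}{k}$ denote the coefficient of $x^k$ in $(1+x+x^2)^n$, and write $a_n\sim b_n$ if $a_n/b_n\to1$ as $n\to\infty$. The edge generating series of the Grand Motzkin lattices is, as a formal power series (the square root being the one with constant term $1$), $$\sum_{n\ge0}\ell(GM_n)\,x^n=\frac{2x^2}{(1-3x)\sqrt{1-2x-3x^2}}.$$ Moreover, for every $n\ge0$, $$\ell(GM_{n+2})=2\sum_{k=0}^n\binom{k;\,3}{k}3^{n-k},$$ $$\ell(GM_{n+2})=\frac{2}{4^n}\sum_{k=0}^n\binom{2k}{k}\binom{2n-2k}{n-k}(2k+1)\,3^k(-1)^{n-k},$$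 $$\ell(GM_{n+2})=2\sum_{k=0}^n\binom{n+1}{k+1}\binom{2k}{k}(-1)^k3^{n-k},$$ and, as $n\to\infty$, $$\ell(GM_n)\sim 2\cdot3^{n-2}\sqrt{\frac{3n}{\pi}}\qquad\text{and}\qquad i(GM_n)\sim\frac49\,n.$$ In particular, the Hasse index of the Grand Motzkin lattices is asymptotically quasi Boolean, i.e. there is a constant $c$ with $0\le c\le 1/10$ such that $i(GM_n)\sim(\tfrac12+c)\,n$ or $i(GM_n)\sim(\tfrac12-c)\,n$. -/

import Mathlib

open Filter Asymptotics Topology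

/-- The number of edges of the Hasse diagram of a poset `P`, i.e. the number of pairs
`(x, y)` such that `y` covers `x`. -/
noncomputable def hasseEdges (P : Type*) [PartialOrder P] : ℕ :=
  Nat.card {e : P × P // e.1 ⋖ e.2}

/-- The Hasse index of a poset: number of edges of the Hasse diagram over number of elements. -/
noncomputable def hasseIndex (P : Type*) [PartialOrder P] : ℝ :=
  (hasseEdges P : ℝ) / (Nat.card P : ℝ)

/-- The edge generating series of a sequence of posets. -/
noncomputable def edgeSeries (P : ℕ → Type*) [∀ n, PartialOrder (P n)] : PowerSeries ℚ :=
  PowerSeries.mk fun n => (hasseEdges (P n) : ℚ)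

/-- The Hasse index of a sequence of posets is asymptotically quasi Boolean if
`i(P_n) ∼ (1/2 ± c) n` for some constant `0 ≤ c ≤ 1/10`. -/
def AsymptoticallyQuasiBoolean (P : ℕ → Type*) [∀ n, PartialOrder (P n)] : Prop :=
  ∃ c : ℝ, 0 ≤ c ∧ c ≤ 1 / 10 ∧
    ((fun n : ℕ => hasseIndex (P n)) ~[atTop] (fun n : ℕ => (1 / 2 + c) * (n : ℝ)) ∨
      (fun n : ℕ => hasseIndex (P n)) ~[atTop] (fun n : ℕ => (1 / 2 - c) * (n : ℝ)))

/-- `S` is the formal square root, with constant term `1`, of the power series `f`. -/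
def IsFormalSqrt (S f : PowerSeries ℚ) : Prop :=
  PowerSeries.constantCoeff S = 1 ∧ S ^ 2 = f

/-- The trinomial coefficient: the coefficient of `x ^ k` in `(1 + x + x ^ 2) ^ n`. -/
noncomputable def trinomial (n k : ℕ) : ℕ :=
  ((1 + Polynomial.X + Polynomial.X ^ 2 : Polynomial ℕ) ^ n).coeff k

/-- The steps `U = (1, 1)`, `D = (1, -1)` and `H = (1, 0)`. -/
inductive MotzkinStep where
  | U
  | D
  | H
deriving DecidableEq

instance : Fintype MotzkinStep :=
  ⟨{MotzkinStep.U, MotzkinStep.D, MotzkinStep.H}, fun s => by cases s <;> simp⟩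

/-- The vertical displacement of a step (the horizontal one is always `1`). -/
def MotzkinStep.rise : MotzkinStep → ℤ
  | .U => 1
  | .D => -1
  | .H => 0

/-- Grand Motzkin paths of length `n`: sequences of `n` steps `U`, `D`, `H` leading from the
origin to a point of the `x`-axis. -/
@[ext]
structure GrandMotzkin (n : ℕ) where
  step : Fin n → MotzkinStep
  ends_on_axis : ∑ i, (step i).rise = 0

namespace GrandMotzkin

variable {n : ℕ}

/-- The ordinate of the point of abscissa `k` of a path, for `k ≤ n`. -/
def height (γ : GrandMotzkin n) (k : ℕ) : ℤ :=
  ∑ i : Fin n with i.val < k, (γ.step i).rise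

theorem height_succ (γ : GrandMotzkin n) (i : Fin n) :
    γ.height (i.val + 1) = γ.height i.val + (γ.step i).rise := by
  unfold height
  have h : (Finset.univ.filter fun j : Fin n => j.val < i.val + 1)
      = insert i (Finset.univ.filter fun j : Fin n => j.val < i.val) := by
    ext j
    simp only [Finset.mem_filter, Finset.mem_univ, true_and, Finset.mem_insert, Fin.ext_iff]
    omega
  rw [h, Finset.sum_insert (by simp), add_comm]

theorem ext_height {γ₁ γ₂ : GrandMotzkin n} (h : ∀ k ≤ n, γ₁.height k = γ₂.height k) :
    γ₁ = γ₂ := by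
  ext i
  have h1 := h i.val i.isLt.le
  have h2 := h (i.val + 1) i.isLt
  rw [height_succ, height_succ, h1, add_right_inj] at h2
  revert h2
  cases γ₁.step i <;> cases γ₂.step i <;> simp [MotzkinStep.rise]

/-- `γ₁ ≤ γ₂` when `γ₁` lies weakly below `γ₂`. -/
instance : PartialOrder (GrandMotzkin n) where
  le γ₁ γ₂ := ∀ k ≤ n, γ₁.height k ≤ γ₂.height k
  le_refl _ _ _ := le_rfl
  le_trans _ _ _ h₁ h₂ k hk := (h₁ k hk).trans (h₂ k hk)
  le_antisymm _ _ h₁ h₂ := ext_height fun k hk => le_antisymm (h₁ k hk) (h₂ k hk)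

instance : Finite (GrandMotzkin n) :=
  Finite.of_injective GrandMotzkin.step fun _ _ h => GrandMotzkin.ext h

end GrandMotzkin

/-! Covers are local moves: they lift one interior point of a path by one unit, which is possible
exactly at a weak local minimum (`exists_raise_le`, `raise_covBy`). Fixing the abscissa of that
minimum restricts two consecutive steps, so a product of generating polynomials counts the paths.
With t_n the central trinomial coefficient, this gives ℓ(GM_{n+2}) = (n+1)(t_n + t_{n+1})
(`hasseEdges_add_two`).

The three-term recurrence of t_n turns this into ℓ(GM_{n+3}) = 3ℓ(GM_{n+2}) + 2t_{n+1}, which yields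
the edge series once the series T of the t_n is known, and two of the sums by induction. The same
recurrence is a differential equation giving T²(1-2x-3x²) = 1, so T = (1-3x)^(-1/2) (1+x)^(-1/2);
the remaining sum is then a Cauchy product.

For the asymptotics, t_n/3^n is a convolution of the coefficients of (1-x)^(-1/2), controlled by
Stirling, with a geometrically small sequence; dominated convergence gives its order
(`tendsto_sqrt_mul_trinomial`). -/

/-! ### Counting paths by generating polynomials. -/

/-- The vertical displacement of a step, shifted by one so as to be a natural number. -/
def MotzkinStep.weight : MotzkinStep → ℕ
  | .U => 2
  | .D => 0
  | .H => 1

namespace MotzkinStep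

theorem rise_eq_weight_sub_one (s : MotzkinStep) : s.rise = (s.weight : ℤ) - 1 := by
  cases s <;> rfl

/-- The step one unit higher (`U` is left unchanged). -/
def up : MotzkinStep → MotzkinStep
  | .U => .U
  | .D => .H
  | .H => .U

/-- The step one unit lower (`D` is left unchanged). -/
def down : MotzkinStep → MotzkinStep
  | .U => .H
  | .D => .D
  | .H => .D

theorem rise_up {s : MotzkinStep} (h : s ≠ U) : s.up.rise = s.rise + 1 := by
  cases s <;> simp_all [up, rise]

theorem rise_down {s : MotzkinStep} (h : s ≠ D) : s.down.rise = s.rise - 1 := by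
  cases s <;> simp_all [down, rise]

theorem sum_rise_eq_zero_iff {n : ℕ} (s : Fin n → MotzkinStep) :
    ∑ i, (s i).rise = 0 ↔ ∑ i, (s i).weight = n := by
  simp only [rise_eq_weight_sub_one, Finset.sum_sub_distrib, Finset.sum_const, Finset.card_univ,
    Fintype.card_fin, nsmul_eq_mul, mul_one, sub_eq_zero]
  norm_cast

end MotzkinStep

open Polynomial in
/-- Counting the step sequences of given total weight whose steps lie in prescribed sets. -/
theorem coeff_prod_sum_X_pow_weight {n : ℕ} (t : Fin n → Finset MotzkinStep) (k : ℕ) :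
    (∏ i, ∑ s ∈ t i, (X : ℕ[X]) ^ s.weight).coeff k
      = ((Fintype.piFinset t).filter fun s => ∑ i, (s i).weight = k).card := by
  rw [Finset.prod_univ_sum, Polynomial.finsetSum_coeff, Finset.card_filter]
  refine Finset.sum_congr rfl fun s _ => ?_
  rw [Finset.prod_pow_eq_pow_sum, Polynomial.coeff_X_pow]
  simp only [eq_comm]

open Polynomial in
theorem sum_X_pow_weight :
    ∑ s : MotzkinStep, (X : ℕ[X]) ^ s.weight = 1 + X + X ^ 2 := by
  have : (Finset.univ : Finset MotzkinStep) = {.U, .D, .H} := rfl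
  rw [this, Finset.sum_insert (by simp), Finset.sum_insert (by simp), Finset.sum_singleton]
  simp only [MotzkinStep.weight]
  ring

namespace GrandMotzkin

variable {n : ℕ}

/-- The paths whose steps lie in prescribed sets are counted by a coefficient of a product. -/
theorem card_step_mem (t : Fin n → Finset MotzkinStep) :
    Nat.card {γ : GrandMotzkin n // ∀ i, γ.step i ∈ t i}
      = (∏ i, ∑ s ∈ t i, (Polynomial.X : Polynomial ℕ) ^ s.weight).coeff n := by
  rw [coeff_prod_sum_X_pow_weight,
    ← Nat.subtype_card (p := fun s => (∀ i, s i ∈ t i) ∧ ∑ i, (s i).weight = n) _ (by simp)]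
  exact Nat.card_congr
    { toFun γ := ⟨γ.1.step, γ.2, (MotzkinStep.sum_rise_eq_zero_iff _).1 γ.1.ends_on_axis⟩
      invFun s := ⟨⟨s.1, (MotzkinStep.sum_rise_eq_zero_iff _).2 s.2.2⟩, s.2.1⟩
      left_inv _ := rfl
      right_inv _ := rfl }

theorem card_eq_trinomial (n : ℕ) : Nat.card (GrandMotzkin n) = trinomial n n := by
  have h := card_step_mem (n := n) fun _ => Finset.univ
  rw [sum_X_pow_weight, Finset.prod_const, Finset.card_univ, Fintype.card_fin] at h
  rw [trinomial, ← h]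
  exact Nat.card_congr (Equiv.subtypeUnivEquiv fun _ _ => Finset.mem_univ _).symm

/-! ### Heights, weak valleys and cover relations. -/

theorem height_zero (γ : GrandMotzkin n) : γ.height 0 = 0 := by
  simp [height]

theorem height_of_le (γ : GrandMotzkin n) {k : ℕ} (h : n ≤ k) : γ.height k = 0 := by
  rw [← γ.ends_on_axis, height, Finset.filter_true_of_mem fun i _ => i.isLt.trans_le h]

theorem abs_height_succ_sub_le (γ : GrandMotzkin n) (k : ℕ) :
    |γ.height (k + 1) - γ.height k| ≤ 1 := by
  rcases lt_or_ge k n with h | h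
  · rw [γ.height_succ ⟨k, h⟩]
    cases γ.step ⟨k, h⟩ <;> simp [MotzkinStep.rise]
  · rw [γ.height_of_le h, γ.height_of_le (h.trans k.le_succ)]
    simp

/-- The point of abscissa `i + 1` of the path is a weak local minimum. -/
def IsValley (γ : GrandMotzkin (n + 2)) (i : Fin (n + 1)) : Prop :=
  γ.step i.castSucc ≠ .U ∧ γ.step i.succ ≠ .D

/-- The steps of the path obtained by moving the point of abscissa `i + 1` one unit upwards. -/
def raiseStep (γ : GrandMotzkin (n + 2)) (i : Fin (n + 1)) : Fin (n + 2) → MotzkinStep :=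
  Function.update (Function.update γ.step i.castSucc (γ.step i.castSucc).up)
    i.succ (γ.step i.succ).down

theorem rise_raiseStep (γ : GrandMotzkin (n + 2)) (i : Fin (n + 1)) (h : γ.IsValley i)
    (j : Fin (n + 2)) :
    (γ.raiseStep i j).rise
      = (γ.step j).rise + ((if j = i.castSucc then 1 else 0) - if j = i.succ then 1 else 0) := by
  have hne : i.castSucc ≠ i.succ := i.castSucc_lt_succ.ne
  unfold raiseStep
  by_cases h₂ : j = i.succ
  · subst h₂
    rw [Function.update_self, MotzkinStep.rise_down h.2, if_neg hne.symm, if_pos rfl]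
    ring
  · rw [Function.update_of_ne h₂, if_neg h₂]
    by_cases h₁ : j = i.castSucc
    · subst h₁
      rw [Function.update_self, MotzkinStep.rise_up h.1, if_pos rfl]
      ring
    · rw [Function.update_of_ne h₁, if_neg h₁]
      ring

/-- The path obtained by moving the point of abscissa `i + 1` one unit upwards. -/
def raise (γ : GrandMotzkin (n + 2)) (i : Fin (n + 1)) (h : γ.IsValley i) :
    GrandMotzkin (n + 2) where
  step := γ.raiseStep i
  ends_on_axis := by
    simp only [γ.rise_raiseStep i h, Finset.sum_add_distrib, Finset.sum_sub_distrib,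
      γ.ends_on_axis, Finset.sum_ite_eq', Finset.mem_univ, if_true, sub_self, add_zero]

theorem height_raise (γ : GrandMotzkin (n + 2)) (i : Fin (n + 1)) (h : γ.IsValley i) (k : ℕ) :
    (γ.raise i h).height k = γ.height k + if k = i + 1 then 1 else 0 := by
  simp only [height, raise, γ.rise_raiseStep i h, Finset.sum_add_distrib, Finset.sum_sub_distrib,
    Finset.sum_ite_eq', Finset.mem_filter, Finset.mem_univ, true_and, Fin.val_castSucc,
    Fin.val_succ]
  split_ifs <;> omega

/-- A path in between agrees with both away from `a`, and at `a` it has to take one of two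
consecutive integers. -/
theorem covBy_of_height {γ₁ γ₂ : GrandMotzkin n} {a : ℕ} (ha : a ≤ n)
    (h : ∀ k, γ₂.height k = γ₁.height k + if k = a then 1 else 0) : γ₁ ⋖ γ₂ := by
  refine ⟨lt_of_le_of_ne (fun k _ => ?_) ?_, fun γ h₁ h₂ => ?_⟩
  · rw [h]
    split_ifs <;> simp
  · rintro rfl
    simpa using h a
  · have hk : ∀ k ≤ n, k ≠ a → γ.height k = γ₁.height k := fun k hk hka => by
      have := h₁.le k hk
      have := h₂.le k hk
      have := h k
      rw [if_neg hka] at this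
      omega
    have h₃ := h₁.le a ha
    have h₄ := h₂.le a ha
    have h₅ := h a
    rw [if_pos rfl] at h₅
    rcases (by omega : γ.height a = γ₁.height a ∨ γ.height a = γ₂.height a) with h₆ | h₆
    · refine h₁.ne' (ext_height fun k hkn => ?_)
      by_cases hka : k = a
      · rw [hka, h₆]
      · exact hk k hkn hka
    · refine h₂.ne (ext_height fun k hkn => ?_)
      by_cases hka : k = a
      · rw [hka, h₆]
      · rw [hk k hkn hka, h, if_neg hka, add_zero]

/-- Take a lowest point of `γ₁` among those strictly below `γ₂`. If it were not a weak valley, a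
neighbour would be one unit lower; since `γ₂` moves by at most one per step, that neighbour would
still lie strictly below `γ₂`, contradicting minimality. -/
theorem exists_raise_le {γ₁ γ₂ : GrandMotzkin (n + 2)} (h : γ₁ < γ₂) :
    ∃ i, ∃ hi : γ₁.IsValley i, γ₁.raise i hi ≤ γ₂ := by
  let s := (Finset.range (n + 3)).filter fun k => γ₁.height k < γ₂.height k
  have hs : s.Nonempty := by
    by_contra hs
    refine h.ne (ext_height fun k hk => le_antisymm (h.le k hk) ?_)
    by_contra hlt
    exact hs ⟨k, Finset.mem_filter.2 ⟨Finset.mem_range.2 (by omega), not_le.1 hlt⟩⟩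
  obtain ⟨k, hk, hmin⟩ := s.exists_min_image γ₁.height hs
  obtain ⟨hkn, hlt⟩ := Finset.mem_filter.1 hk
  rw [Finset.mem_range] at hkn
  -- Both paths have height 0 at the two ends, so the chosen point is interior.
  have hk0 : k ≠ 0 := by
    rintro rfl
    simp [height_zero] at hlt
  have hk1 : k ≠ n + 2 := by
    rintro rfl
    simp [height_of_le] at hlt
  obtain ⟨i, rfl⟩ := Nat.exists_eq_succ_of_ne_zero hk0
  have hmin' : ∀ j < n + 3, γ₁.height j < γ₂.height j →
      γ₁.height (i + 1) ≤ γ₁.height j := fun j hj hj' =>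
    hmin j (Finset.mem_filter.2 ⟨Finset.mem_range.2 hj, hj'⟩)
  have hi : i < n + 1 := by omega
  have hv : γ₁.IsValley ⟨i, hi⟩ := by
    constructor
    · intro hU
      have h₁ := γ₁.height_succ (Fin.castSucc ⟨i, hi⟩)
      have h₂ := abs_le.1 (γ₂.abs_height_succ_sub_le i)
      have h₃ := hmin' i (by omega)
      simp only [hU, MotzkinStep.rise, Fin.val_castSucc] at h₁
      simp only [Nat.succ_eq_add_one] at hlt
      omega
    · intro hD
      have h₁ := γ₁.height_succ (Fin.succ ⟨i, hi⟩)
      have h₂ := abs_le.1 (γ₂.abs_height_succ_sub_le (i + 1))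
      have h₃ := hmin' (i + 1 + 1) (by omega)
      simp only [hD, MotzkinStep.rise, Fin.val_succ] at h₁
      simp only [Nat.succ_eq_add_one] at hlt
      omega
  refine ⟨⟨i, hi⟩, hv, fun k hkn => ?_⟩
  have := h.le k hkn
  rw [height_raise]
  split_ifs with hki
  · subst hki
    exact hlt
  · simpa using this

theorem raise_covBy (γ : GrandMotzkin (n + 2)) (i : Fin (n + 1)) (h : γ.IsValley i) :
    γ ⋖ γ.raise i h :=
  covBy_of_height (by omega) (γ.height_raise i h)

open Polynomial in
theorem card_isValley (i : Fin (n + 1)) :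
    Nat.card {γ : GrandMotzkin (n + 2) // γ.IsValley i}
      = trinomial n n + trinomial (n + 1) (n + 1) := by
  have hne : i.castSucc ≠ i.succ := i.castSucc_lt_succ.ne
  let t : Fin (n + 2) → Finset MotzkinStep := fun j =>
    if j = i.castSucc then {.D, .H} else if j = i.succ then {.U, .H} else Finset.univ
  have ht : ∀ γ : GrandMotzkin (n + 2), γ.IsValley i ↔ ∀ j, γ.step j ∈ t j := fun γ => by
    constructor
    · rintro ⟨h₁, h₂⟩ j
      simp only [t]
      split_ifs with h h'
      · subst h
        revert h₁
        cases γ.step i.castSucc <;> simp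
      · subst h'
        revert h₂
        cases γ.step i.succ <;> simp
      · exact Finset.mem_univ _
    · intro h
      have h₁ := h i.castSucc
      have h₂ := h i.succ
      simp only [t, if_true, if_neg hne.symm] at h₁ h₂
      constructor
      · rintro h₀
        simp [h₀] at h₁
      · rintro h₀
        simp [h₀] at h₂
  rw [Nat.card_congr (Equiv.subtypeEquivRight ht), card_step_mem]
  -- The two restricted steps contribute (1 + X)(X² + X) = X(X + (1 + X + X²)), whence the two
  -- trinomial terms.
  have hprod : ∏ j, ∑ s ∈ t j, (X : ℕ[X]) ^ s.weight
      = (X * (X * (1 + X + X ^ 2) ^ n + (1 + X + X ^ 2) ^ (n + 1)) : ℕ[X]) := by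
    rw [← Finset.mul_prod_erase _ _ (Finset.mem_univ i.castSucc),
      ← Finset.mul_prod_erase _ _ (Finset.mem_erase.2 ⟨hne.symm, Finset.mem_univ i.succ⟩),
      Finset.prod_congr rfl (g := fun _ => (1 + X + X ^ 2 : ℕ[X]))]
    · rw [Finset.prod_const, Finset.card_erase_of_mem
        (Finset.mem_erase.2 ⟨hne.symm, Finset.mem_univ _⟩), Finset.card_erase_of_mem
        (Finset.mem_univ _), Finset.card_univ, Fintype.card_fin]
      simp only [t, if_true, if_neg hne.symm]
      rw [Finset.sum_pair (by simp), Finset.sum_pair (by simp)]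
      simp only [MotzkinStep.weight, Nat.add_sub_cancel]
      ring
    · intro j hj
      obtain ⟨h₂, h₁, -⟩ := by simpa only [Finset.mem_erase] using hj
      simp only [t, if_neg h₁, if_neg h₂]
      exact sum_X_pow_weight
  rw [hprod, coeff_X_mul, coeff_add, coeff_X_mul]
  rfl

/-- Covers correspond bijectively to paths with a marked weak valley: the heights reveal the raised
abscissa, and a cover leaves no room above the raise provided by `exists_raise_le`. -/
theorem hasseEdges_add_two (n : ℕ) :
    hasseEdges (GrandMotzkin (n + 2))
      = (n + 1) * (trinomial n n + trinomial (n + 1) (n + 1)) := by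
  let f : (Σ i : Fin (n + 1), {γ : GrandMotzkin (n + 2) // γ.IsValley i}) →
      {e : GrandMotzkin (n + 2) × GrandMotzkin (n + 2) // e.1 ⋖ e.2} :=
    fun x => ⟨(x.2.1, x.2.1.raise x.1 x.2.2), x.2.1.raise_covBy x.1 x.2.2⟩
  have hf : Function.Bijective f := by
    constructor
    · rintro ⟨i, γ, hi⟩ ⟨j, γ', hj⟩ hij
      simp only [f, Subtype.mk.injEq, Prod.mk.injEq] at hij
      obtain ⟨rfl, hij⟩ := hij
      have h := congrArg (fun δ => δ.height (i + 1)) hij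
      simp only [height_raise, if_true] at h
      have : i = j := by
        by_contra hne
        rw [if_neg (by omega)] at h
        omega
      subst this
      rfl
    · rintro ⟨⟨γ₁, γ₂⟩, hc⟩
      obtain ⟨i, hi, hle⟩ := exists_raise_le hc.lt
      refine ⟨⟨i, γ₁, hi⟩, ?_⟩
      simp only [f, Subtype.mk.injEq, Prod.mk.injEq, true_and]
      exact hle.eq_of_not_lt fun hlt => hc.2 (γ₁.raise_covBy i hi).lt hlt
  rw [hasseEdges, ← Nat.card_congr (Equiv.ofBijective f hf), Nat.card_sigma]
  simp [card_isValley]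

theorem hasseEdges_of_le_one {n : ℕ} (hn : n ≤ 1) : hasseEdges (GrandMotzkin n) = 0 := by
  have : Subsingleton (GrandMotzkin n) := ⟨fun a b => ext_height fun k hk => by
    rcases Nat.eq_zero_or_pos k with rfl | h
    · rw [height_zero, height_zero]
    · rw [height_of_le _ (by omega), height_of_le _ (by omega)]⟩
  have : IsEmpty {e : GrandMotzkin n × GrandMotzkin n // e.1 ⋖ e.2} :=
    ⟨fun e => e.2.ne (Subsingleton.elim _ _)⟩
  exact Nat.card_of_isEmpty

end GrandMotzkin

/-! ### Recurrences and the sums obtained by induction. -/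

section Recurrence

open Polynomial hiding trinomial

theorem trinomial_zero_zero : trinomial 0 0 = 1 := by
  simp [trinomial]

theorem trinomial_one_one : trinomial 1 1 = 1 := by
  simp [trinomial, coeff_X, coeff_one]

theorem trinomial_succ_add_two (n k : ℕ) :
    trinomial (n + 1) (k + 2) = trinomial n (k + 2) + trinomial n (k + 1) + trinomial n k := by
  have : (1 + X + X ^ 2 : ℕ[X]) ^ (n + 1)
      = (1 + X + X ^ 2) ^ n + X * (1 + X + X ^ 2) ^ n + X * (X * (1 + X + X ^ 2) ^ n) := by ring
  simp only [trinomial, this, coeff_add, coeff_X_mul]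

/-- Compare coefficients in the derivative of (1 + X + X²)^(n+1). -/
theorem add_two_mul_trinomial_succ (n k : ℕ) :
    (k + 2) * trinomial (n + 1) (k + 2)
      = (n + 1) * (trinomial n (k + 1) + 2 * trinomial n k) := by
  have h : derivative ((1 + X + X ^ 2 : ℕ[X]) ^ (n + 1))
      = C (n + 1) * ((1 + X + X ^ 2) ^ n + 2 * (X * (1 + X + X ^ 2) ^ n)) := by
    rw [derivative_pow_succ]
    simp only [derivative_add, derivative_one, derivative_X, derivative_X_pow]
    push_cast
    simp only [map_add, map_one, map_ofNat]
    ring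
  have h' := congrArg (fun p => p.coeff (k + 1)) h
  simp only [coeff_derivative, coeff_C_mul, coeff_add, coeff_ofNat_mul, coeff_X_mul] at h'
  simp only [trinomial]
  rw [← h', mul_comm]
  push_cast
  ring

/-- The three-term recurrence of the central trinomial coefficients. -/
theorem trinomial_recurrence (n : ℕ) :
    (n + 2) * trinomial (n + 2) (n + 2)
      = (2 * n + 3) * trinomial (n + 1) (n + 1) + 3 * (n + 1) * trinomial n n := by
  rcases n with - | n
  · have h := add_two_mul_trinomial_succ 1 0
    have h₀ : trinomial 1 0 = 1 := by simp [trinomial]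
    simpa [trinomial_zero_zero, trinomial_one_one, h₀] using h
  · have h₁ := trinomial_succ_add_two (n + 2) (n + 1)
    have h₂ := add_two_mul_trinomial_succ (n + 2) (n + 1)
    have h₃ := trinomial_succ_add_two (n + 1) n
    have h₄ := add_two_mul_trinomial_succ (n + 1) n
    have h₅ := add_two_mul_trinomial_succ (n + 1) (n + 1)
    simp only [add_assoc, Nat.reduceAdd] at *
    zify at *
    -- On the diagonal the numerical factors of the derivative identity coincide and cancel. The
    -- off-diagonal coefficients are then eliminated linearly.
    have e₂ : (trinomial (n + 3) (n + 3) : ℤ)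
        = trinomial (n + 2) (n + 2) + 2 * trinomial (n + 2) (n + 1) :=
      mul_left_cancel₀ (by positivity : (n : ℤ) + 3 ≠ 0) (by linear_combination h₂)
    have e₄ : (trinomial (n + 2) (n + 2) : ℤ)
        = trinomial (n + 1) (n + 1) + 2 * trinomial (n + 1) n :=
      mul_left_cancel₀ (by positivity : (n : ℤ) + 2 ≠ 0) (by linear_combination h₄)
    linear_combination 2 * h₅ + (2 * n + 6) * h₁ - (n + 3) * e₂ - (n + 2) * (2 * h₃ - e₄)

theorem hasseEdges_add_three (n : ℕ) :
    hasseEdges (GrandMotzkin (n + 3))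
      = 3 * hasseEdges (GrandMotzkin (n + 2)) + 2 * trinomial (n + 1) (n + 1) := by
  rw [GrandMotzkin.hasseEdges_add_two n, GrandMotzkin.hasseEdges_add_two (n + 1)]
  have := trinomial_recurrence n
  linarith

theorem hasseEdges_two : hasseEdges (GrandMotzkin 2) = 2 := by
  rw [GrandMotzkin.hasseEdges_add_two, trinomial_zero_zero, trinomial_one_one]

theorem hasseEdges_eq_sum_trinomial (n : ℕ) :
    hasseEdges (GrandMotzkin (n + 2))
      = 2 * ∑ k ∈ Finset.range (n + 1), trinomial k k * 3 ^ (n - k) := by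
  induction n with
  | zero => simp [hasseEdges_two, trinomial_zero_zero]
  | succ n ih =>
    rw [hasseEdges_add_three, ih, Finset.sum_range_succ _ (n + 1), Nat.sub_self, pow_zero, mul_one,
      mul_add, add_left_inj, mul_left_comm, Finset.mul_sum]
    congr 1
    refine Finset.sum_congr rfl fun k hk => ?_
    rw [Nat.succ_sub (Finset.mem_range_succ_iff.1 hk), pow_succ]
    ring

/-- Expand 1 + X + X² = (1 - X)² + 3X. Writing (1 - X)^(2k) as (1 + X)^(2k) composed with -X makes
its middle coefficient readable. -/
theorem trinomial_eq_sum_centralBinom (n : ℕ) :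
    (trinomial n n : ℤ)
      = ∑ k ∈ Finset.range (n + 1), (n.choose k : ℤ) * (Nat.choose (2 * k) k : ℤ)
          * (-1) ^ k * 3 ^ (n - k) := by
  have h : ((1 + X + X ^ 2 : ℕ[X]) ^ n).map (Nat.castRingHom ℤ)
      = ∑ k ∈ Finset.range (n + 1), C ((n.choose k : ℤ) * 3 ^ (n - k))
          * (X ^ (n - k) * ((1 + X) ^ (2 * k)).comp (C (-1) * X)) := by
    simp only [Polynomial.map_pow, Polynomial.map_add, Polynomial.map_one, map_X]
    rw [show (1 + X + X ^ 2 : ℤ[X]) = (1 - X) ^ 2 + C 3 * X by rw [C_ofNat]; ring, add_pow]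
    refine Finset.sum_congr rfl fun k _ => ?_
    simp only [pow_comp, add_comp, one_comp, X_comp, C_neg, C_1, neg_one_mul, ← sub_eq_add_neg,
      mul_pow, ← pow_mul, C_mul, C_pow, map_natCast]
    ring
  rw [trinomial, ← eq_natCast (Nat.castRingHom ℤ), ← coeff_map, h, finsetSum_coeff]
  refine Finset.sum_congr rfl fun k hk => ?_
  rw [coeff_C_mul, coeff_X_pow_mul', if_pos (Nat.sub_le n k),
    Nat.sub_sub_self (Finset.mem_range_succ_iff.1 hk), comp_C_mul_X_coeff, coeff_one_add_X_pow]
  ring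

/-- Pascal's rule splits the next sum into three times the old one and the expansion of the
trinomial coefficient. -/
theorem hasseEdges_eq_sum_choose (n : ℕ) :
    (hasseEdges (GrandMotzkin (n + 2)) : ℤ)
      = 2 * ∑ k ∈ Finset.range (n + 1),
          (Nat.choose (n + 1) (k + 1) : ℤ) * (Nat.choose (2 * k) k : ℤ)
            * (-1) ^ k * 3 ^ (n - k) := by
  induction n with
  | zero => simp [hasseEdges_two]
  | succ n ih =>
    rw [hasseEdges_add_three]
    push_cast
    rw [ih, trinomial_eq_sum_centralBinom, mul_left_comm, ← mul_add, Finset.mul_sum,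
      Finset.sum_range_succ _ (n + 1), Finset.sum_range_succ _ (n + 1), ← add_assoc,
      ← Finset.sum_add_distrib]
    congr 2
    · refine Finset.sum_congr rfl fun k hk => ?_
      rw [Nat.choose_succ_succ (n + 1) k, Nat.succ_sub (Finset.mem_range_succ_iff.1 hk), pow_succ]
      push_cast
      ring
    · simp

end Recurrence

/-! ### Formal power series and the convolution formula. -/

section Series

open PowerSeries

/-- The expansion of `(1 - a x) ^ (-1 / 2)`. -/
noncomputable def invSqrtSeries (a : ℚ) : ℚ⟦X⟧ :=
  PowerSeries.mk fun k => (k.centralBinom : ℚ) * (a / 4) ^ k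

/-- The expansion of `(1 - a x) ^ (-3 / 2)`. -/
noncomputable def invSqrtCubeSeries (a : ℚ) : ℚ⟦X⟧ :=
  PowerSeries.mk fun k => (k.centralBinom : ℚ) * (2 * k + 1) * (a / 4) ^ k

/-- The generating series of the central trinomial coefficients. -/
noncomputable def trinomialSeries : ℚ⟦X⟧ :=
  PowerSeries.mk fun k => (trinomial k k : ℚ)

theorem succ_mul_centralBinom_succ_rat (k : ℕ) :
    ((k : ℚ) + 1) * (k + 1).centralBinom = 2 * (2 * k + 1) * k.centralBinom := by
  exact_mod_cast Nat.succ_mul_centralBinom_succ k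

theorem derivative_invSqrtSeries (a : ℚ) :
    d⁄dX ℚ (invSqrtSeries a) = C (a / 2) * invSqrtCubeSeries a := by
  ext n
  rw [coeff_derivative, coeff_C_mul, invSqrtSeries, invSqrtCubeSeries, coeff_mk, coeff_mk, pow_succ]
  linear_combination (a / 4) ^ n * (a / 4) * succ_mul_centralBinom_succ_rat n

theorem invSqrtCubeSeries_mul (a : ℚ) :
    invSqrtCubeSeries a * (1 - C a * X) = invSqrtSeries a := by
  ext n
  rw [mul_sub, mul_one, mul_left_comm, map_sub, coeff_C_mul, invSqrtSeries, invSqrtCubeSeries]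
  rcases n with - | n
  · simp
  · rw [coeff_succ_mul_X, coeff_mk, coeff_mk, coeff_mk, pow_succ]
    push_cast
    linear_combination 2 * (a / 4) ^ n * (a / 4) * succ_mul_centralBinom_succ_rat n

/-- Over ℚ a series is determined by its derivative and constant term; here the derivative of the
left side vanishes. -/
theorem invSqrtSeries_sq (a : ℚ) : invSqrtSeries a ^ 2 * (1 - C a * X) = 1 := by
  refine derivative.ext ?_ (by simp [invSqrtSeries])
  have h : (2 : ℚ⟦X⟧) * C (a / 2) = C a := by
    rw [← map_ofNat C, ← map_mul]
    congr 1
    ring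
  simp only [Derivation.leibniz, Derivation.leibniz_pow, map_sub, derivative_C, derivative_X,
    derivative_invSqrtSeries, smul_eq_mul, Derivation.map_one_eq_zero, nsmul_eq_mul]
  push_cast
  linear_combination 2 * invSqrtSeries a * C (a / 2) * invSqrtCubeSeries_mul a
    + invSqrtSeries a ^ 2 * h

/-- This is `trinomial_recurrence` read as a differential equation. -/
theorem derivative_trinomialSeries :
    (1 - 2 * X - 3 * X ^ 2) * d⁄dX ℚ trinomialSeries = (1 + 3 * X) * trinomialSeries := by
  have h₁ : (1 - 2 * X - 3 * X ^ 2) * d⁄dX ℚ trinomialSeries = d⁄dX ℚ trinomialSeries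
      - C 2 * (X * d⁄dX ℚ trinomialSeries) - C 3 * (X * (X * d⁄dX ℚ trinomialSeries)) := by
    simp only [map_ofNat]
    ring
  have h₂ : (1 + 3 * X) * trinomialSeries = trinomialSeries + C 3 * (X * trinomialSeries) := by
    simp only [map_ofNat]
    ring
  rw [h₁, h₂]
  ext n
  simp only [map_sub, map_add, coeff_C_mul]
  rcases n with - | - | n
  · simp [trinomialSeries, coeff_derivative, trinomial_one_one, trinomial_zero_zero]
  · have h := trinomial_recurrence 0
    have h' : (2 : ℚ) * trinomial 2 2 = 3 * trinomial 1 1 + 3 * trinomial 0 0 := by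
      exact_mod_cast h
    simp [trinomialSeries, coeff_derivative, trinomial_one_one, trinomial_zero_zero,
      coeff_succ_X_mul] at h' ⊢
    linarith
  · have h := trinomial_recurrence (n + 1)
    simp only [coeff_succ_X_mul, trinomialSeries, coeff_derivative, coeff_mk]
    have h' : ((n : ℚ) + 1 + 2) * trinomial (n + 3) (n + 3)
        = (2 * (n + 1) + 3) * trinomial (n + 2) (n + 2)
          + 3 * (n + 1 + 1) * trinomial (n + 1) (n + 1) := by exact_mod_cast h
    push_cast
    linear_combination h'

theorem trinomialSeries_sq : trinomialSeries ^ 2 * (1 - 2 * X - 3 * X ^ 2) = 1 := by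
  refine derivative.ext ?_ (by simp [trinomialSeries, trinomial_zero_zero])
  have h2 : d⁄dX ℚ (2 : ℚ⟦X⟧) = 0 := by rw [← map_ofNat C, derivative_C]
  have h3 : d⁄dX ℚ (3 : ℚ⟦X⟧) = 0 := by rw [← map_ofNat C, derivative_C]
  simp only [Derivation.leibniz, Derivation.leibniz_pow, map_sub, h2, h3, derivative_X,
    smul_eq_mul, Derivation.map_one_eq_zero, nsmul_eq_mul]
  push_cast
  linear_combination 2 * trinomialSeries * derivative_trinomialSeries

/-- Since 1 - 2X - 3X² = (1 - 3X)(1 + X), both sides have the same square; the constant terms fix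
the sign. -/
theorem trinomialSeries_eq_mul :
    trinomialSeries = invSqrtSeries 3 * invSqrtSeries (-1) := by
  have h₁ := invSqrtSeries_sq 3
  have h₂ := invSqrtSeries_sq (-1)
  simp only [map_neg, map_one, map_ofNat] at h₁ h₂
  have hne : (1 - 2 * X - 3 * X ^ 2 : ℚ⟦X⟧) ≠ 0 := fun h => by
    simpa [h] using trinomialSeries_sq
  have hsq : trinomialSeries ^ 2 = (invSqrtSeries 3 * invSqrtSeries (-1)) ^ 2 := by
    refine mul_right_cancel₀ hne ?_
    linear_combination trinomialSeries_sq - h₁ * invSqrtSeries (-1) ^ 2 * (1 + X) - h₂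
  refine (sq_eq_sq_iff_eq_or_eq_neg.1 hsq).resolve_right fun h => ?_
  have := congrArg constantCoeff h
  norm_num [trinomialSeries, invSqrtSeries, trinomial_zero_zero] at this

theorem edgeSeries_mul :
    edgeSeries GrandMotzkin * (1 - 3 * X) = 2 * X ^ 2 * trinomialSeries := by
  have h₁ : edgeSeries GrandMotzkin * (1 - 3 * X)
      = edgeSeries GrandMotzkin - C 3 * (X * edgeSeries GrandMotzkin) := by
    simp only [map_ofNat]
    ring
  have h₂ : 2 * X ^ 2 * trinomialSeries = C 2 * (X * (X * trinomialSeries)) := by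
    simp only [map_ofNat]
    ring
  rw [h₁, h₂]
  ext n
  simp only [map_sub, coeff_C_mul, edgeSeries]
  rcases n with - | - | - | n
  · simp [GrandMotzkin.hasseEdges_of_le_one]
  · simp [GrandMotzkin.hasseEdges_of_le_one, coeff_succ_X_mul]
  · simp [GrandMotzkin.hasseEdges_of_le_one, coeff_succ_X_mul, hasseEdges_two, trinomialSeries,
      trinomial_zero_zero]
  · simp only [coeff_succ_X_mul, trinomialSeries, coeff_mk]
    have := hasseEdges_add_three n
    rw [show n + 1 + 1 + 1 = n + 3 from rfl, this]
    push_cast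
    ring

theorem edgeSeries_eq :
    ∃ S : ℚ⟦X⟧, IsFormalSqrt S (1 - 2 * X - 3 * X ^ 2) ∧
      edgeSeries GrandMotzkin = 2 * X ^ 2 * ((1 - 3 * X) * S)⁻¹ := by
  have hT : constantCoeff trinomialSeries = 1 := by simp [trinomialSeries, trinomial_zero_zero]
  have hS : trinomialSeries * trinomialSeries⁻¹ = 1 :=
    PowerSeries.mul_inv_cancel _ (by simp [hT])
  -- The square root is the inverse of the trinomial series.
  refine ⟨trinomialSeries⁻¹, ⟨by simp [hT], ?_⟩, ?_⟩
  · linear_combination (-trinomialSeries⁻¹ ^ 2) * trinomialSeries_sq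
      + (1 - 2 * X - 3 * X ^ 2) * (trinomialSeries * trinomialSeries⁻¹ + 1) * hS
  · rw [PowerSeries.eq_mul_inv_iff_mul_eq (by simp [hT]), ← mul_assoc, edgeSeries_mul]
    linear_combination 2 * X ^ 2 * hS

/-- The extra factor (1 - 3X)⁻¹ raises the exponent -1/2 to -3/2. -/
theorem edgeSeries_eq_mul :
    edgeSeries GrandMotzkin
      = 2 * (X * (X * (invSqrtCubeSeries 3 * invSqrtSeries (-1)))) := by
  have h := invSqrtCubeSeries_mul 3
  simp only [map_ofNat] at h
  have hne : (1 - 3 * X : ℚ⟦X⟧) ≠ 0 := fun h' => by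
    simpa using congrArg constantCoeff h'
  refine mul_right_cancel₀ hne ?_
  rw [edgeSeries_mul, trinomialSeries_eq_mul]
  linear_combination (-2 * X ^ 2 * invSqrtSeries (-1)) * h

theorem hasseEdges_eq_convolution (n : ℕ) :
    (hasseEdges (GrandMotzkin (n + 2)) : ℚ)
      = 2 / 4 ^ n * ∑ k ∈ Finset.range (n + 1),
          (Nat.choose (2 * k) k : ℚ) * (Nat.choose (2 * n - 2 * k) (n - k) : ℚ)
            * (2 * (k : ℚ) + 1) * 3 ^ k * (-1) ^ (n - k) := by
  have h := congrArg (coeff (n + 2)) edgeSeries_eq_mul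
  rw [← map_ofNat C, coeff_C_mul, coeff_succ_X_mul, coeff_succ_X_mul, coeff_mul,
    Finset.Nat.sum_antidiagonal_eq_sum_range_succ_mk, edgeSeries, coeff_mk] at h
  rw [h, div_mul_eq_mul_div, mul_div_assoc, Finset.sum_div]
  congr 1
  refine Finset.sum_congr rfl fun k hk => ?_
  have hk' := Finset.mem_range_succ_iff.1 hk
  simp only [invSqrtCubeSeries, invSqrtSeries, coeff_mk, Nat.centralBinom_eq_two_mul_choose,
    Nat.mul_sub, div_pow]
  rw [← Nat.add_sub_of_le hk', pow_add (4 : ℚ)]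
  simp only [Nat.add_sub_cancel_left]
  field_simp

end Series

/-! ### Stirling, dominated convergence and asymptotic equivalents. -/

section Asymptotics

/-- The coefficients of `(1 - x) ^ (-1 / 2)`. -/
noncomputable def invSqrtCoeff (k : ℕ) : ℝ :=
  (k.centralBinom : ℝ) / 4 ^ k

theorem invSqrtCoeff_nonneg (k : ℕ) : 0 ≤ invSqrtCoeff k := by
  unfold invSqrtCoeff
  positivity

theorem invSqrtCoeff_zero : invSqrtCoeff 0 = 1 := by
  simp [invSqrtCoeff]

theorem invSqrtCoeff_succ (k : ℕ) :
    invSqrtCoeff (k + 1) = (2 * k + 1) / (2 * k + 2) * invSqrtCoeff k := by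
  have h : ((k : ℝ) + 1) * (k + 1).centralBinom = 2 * (2 * k + 1) * k.centralBinom := by
    exact_mod_cast Nat.succ_mul_centralBinom_succ k
  unfold invSqrtCoeff
  rw [pow_succ]
  field_simp
  linear_combination 2 * h

/-- The left side is nonincreasing in `k`, because (k+2)(2k+1)² ≤ (k+1)(2k+2)². -/
theorem succ_mul_invSqrtCoeff_sq_le (k : ℕ) : (k + 1) * invSqrtCoeff k ^ 2 ≤ 1 := by
  induction k with
  | zero => simp [invSqrtCoeff_zero]
  | succ k ih =>
    refine le_trans ?_ ih
    rw [invSqrtCoeff_succ, mul_pow, ← mul_assoc]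
    refine mul_le_mul_of_nonneg_right ?_ (sq_nonneg _)
    push_cast
    rw [div_pow, mul_div_assoc', div_le_iff₀ (by positivity)]
    nlinarith [sq_nonneg (k : ℝ), (Nat.cast_nonneg k : (0 : ℝ) ≤ k)]

/-- A bound uniform in `n`; its growth in `j` is harmless against the factor 3^(-j) in the dominated
convergence. -/
theorem sqrt_mul_invSqrtCoeff_sub_le {n j : ℕ} (h : j ≤ n) :
    √n * invSqrtCoeff (n - j) ≤ j + 1 := by
  obtain ⟨m, rfl⟩ := Nat.exists_eq_add_of_le h
  rw [Nat.add_sub_cancel_left]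
  refine le_of_sq_le_sq ?_ (by positivity)
  rw [mul_pow, Real.sq_sqrt (by positivity)]
  have h₁ := succ_mul_invSqrtCoeff_sq_le m
  have h₂ := sq_nonneg (invSqrtCoeff m)
  push_cast
  calc ((j : ℝ) + m) * invSqrtCoeff m ^ 2
      ≤ ((j : ℝ) + 1) * ((m + 1) * invSqrtCoeff m ^ 2) := by
        rw [← mul_assoc]
        refine mul_le_mul_of_nonneg_right ?_ h₂
        nlinarith [mul_nonneg (Nat.cast_nonneg j : (0 : ℝ) ≤ j) (Nat.cast_nonneg m : (0 : ℝ) ≤ m)]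
    _ ≤ ((j : ℝ) + 1) * 1 := by gcongr
    _ ≤ ((j : ℝ) + 1) ^ 2 := by nlinarith [(Nat.cast_nonneg j : (0 : ℝ) ≤ j)]

theorem invSqrtCoeff_le_one (k : ℕ) : invSqrtCoeff k ≤ 1 := by
  rw [invSqrtCoeff, div_le_one (by positivity)]
  exact_mod_cast Nat.centralBinom_le_four_pow k

theorem sqrt_mul_invSqrtCoeff_eq {k : ℕ} (hk : k ≠ 0) :
    √k * invSqrtCoeff k = Stirling.stirlingSeq (2 * k) / Stirling.stirlingSeq k ^ 2 := by
  have h : (k.centralBinom : ℝ) * (k.factorial * k.factorial) = (2 * k).factorial := by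
    have := Nat.add_choose_mul_factorial_mul_factorial k k
    rw [← two_mul, ← Nat.centralBinom_eq_two_mul_choose, mul_assoc] at this
    exact_mod_cast this
  have hk' : (0 : ℝ) < k := by positivity
  have hs : √(2 * ((2 : ℝ) * k)) = 2 * √k := by
    rw [← mul_assoc, Real.sqrt_mul (by norm_num), show (2 : ℝ) * 2 = 2 ^ 2 by norm_num,
      Real.sqrt_sq (by norm_num)]
  have hsq : √(2 * (k : ℝ)) ^ 2 = 2 * k := Real.sq_sqrt (by positivity)
  have hkk : √(k : ℝ) ^ 2 = k := Real.sq_sqrt hk'.le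
  have hk2 : (0 : ℝ) < √k := Real.sqrt_pos.2 hk'
  unfold Stirling.stirlingSeq invSqrtCoeff
  rw [← h]
  push_cast
  have he : (2 * (k : ℝ) / Real.exp 1) ^ (2 * k) = 4 ^ k * ((k / Real.exp 1) ^ k) ^ 2 := by
    rw [mul_div_assoc, mul_pow, pow_mul, ← pow_mul (_ / _), mul_comm k 2]
    norm_num
  rw [hs, he, div_pow _ _ 2, mul_pow _ _ 2, hsq]
  field_simp
  rw [hkk]
  ring

theorem tendsto_sqrt_mul_invSqrtCoeff :
    Tendsto (fun k : ℕ => √k * invSqrtCoeff k) atTop (𝓝 (1 / √Real.pi)) := by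
  have h := Stirling.tendsto_stirlingSeq_sqrt_pi
  have hpi : √Real.pi ≠ 0 := (Real.sqrt_pos.2 Real.pi_pos).ne'
  have h₂ := (h.comp (tendsto_id.const_mul_atTop' (two_pos : (0 : ℕ) < 2))).div (h.pow 2)
    (pow_ne_zero 2 hpi)
  have hlim : √Real.pi / √Real.pi ^ 2 = 1 / √Real.pi := by
    field_simp
  rw [hlim] at h₂
  refine h₂.congr' ?_
  filter_upwards [eventually_ne_atTop 0] with k hk
  exact (sqrt_mul_invSqrtCoeff_eq hk).symm

theorem tendsto_sqrt_mul_invSqrtCoeff_sub (j : ℕ) :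
    Tendsto (fun n : ℕ => √n * invSqrtCoeff (n - j)) atTop (𝓝 (1 / √Real.pi)) := by
  rw [← tendsto_add_atTop_iff_nat j]
  have h : Tendsto (fun m : ℕ => √((m : ℝ) / (m + j))) atTop (𝓝 1) := by
    simpa using (tendsto_natCast_div_add_atTop (j : ℝ)).sqrt
  have h₂ := tendsto_sqrt_mul_invSqrtCoeff.div h one_ne_zero
  rw [div_one] at h₂
  refine h₂.congr' ?_
  filter_upwards [eventually_ne_atTop 0] with m hm
  have hm' : (0 : ℝ) < m := by positivity
  have hs : (0 : ℝ) < √m := Real.sqrt_pos.2 hm'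
  simp only [Pi.div_apply, Nat.add_sub_cancel]
  rw [Real.sqrt_div hm'.le]
  push_cast
  field_simp

/-- The square of (1 - x)^(-1/2) is the geometric series. -/
theorem sum_invSqrtCoeff_mul (n : ℕ) :
    ∑ p ∈ Finset.HasAntidiagonal.antidiagonal n, invSqrtCoeff p.1 * invSqrtCoeff p.2 = 1 := by
  have h : invSqrtSeries 1 ^ 2 = PowerSeries.mk 1 := by
    have h₁ := invSqrtSeries_sq 1
    have h₂ := PowerSeries.mk_one_mul_one_sub_eq_one ℚ
    rw [map_one, one_mul] at h₁
    linear_combination (PowerSeries.mk 1) * h₁ - invSqrtSeries 1 ^ 2 * h₂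
  have h' := congrArg (PowerSeries.coeff n) h
  rw [sq, PowerSeries.coeff_mul, PowerSeries.coeff_mk] at h'
  have h'' := congrArg (fun q : ℚ => (q : ℝ)) h'
  simp only [invSqrtSeries, PowerSeries.coeff_mk] at h''
  push_cast at h''
  simpa [invSqrtCoeff, div_eq_mul_inv] using h''

theorem norm_invSqrtCoeff_mul_pow_le (j : ℕ) :
    ‖invSqrtCoeff j * (-1 / 3) ^ j‖ ≤ (1 / 3) ^ j := by
  rw [norm_mul, norm_pow, Real.norm_of_nonneg (invSqrtCoeff_nonneg j)]
  norm_num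
  exact invSqrtCoeff_le_one j

/-- This is (1 + 1/3)^(-1/2). The Cauchy square is a geometric series of sum 3/4, and the sum is
positive because the tail is at most 1/2 against a leading term 1. -/
theorem tsum_invSqrtCoeff_mul_pow :
    ∑' j, invSqrtCoeff j * (-1 / 3) ^ j = √3 / 2 := by
  have hg : Summable fun j : ℕ => ((1 : ℝ) / 3) ^ j :=
    summable_geometric_of_lt_one (by norm_num) (by norm_num)
  have hs : Summable fun j : ℕ => ‖invSqrtCoeff j * (-1 / 3) ^ j‖ :=
    hg.of_nonneg_of_le (fun _ => norm_nonneg _) norm_invSqrtCoeff_mul_pow_le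
  have hsq : (∑' j, invSqrtCoeff j * (-1 / 3) ^ j) * (∑' j, invSqrtCoeff j * (-1 / 3) ^ j)
      = 3 / 4 := by
    rw [tsum_mul_tsum_eq_tsum_sum_antidiagonal_of_summable_norm hs hs]
    have : ∀ n : ℕ, ∑ p ∈ Finset.HasAntidiagonal.antidiagonal n,
        invSqrtCoeff p.1 * (-1 / 3) ^ p.1 * (invSqrtCoeff p.2 * (-1 / 3) ^ p.2)
          = (-1 / 3 : ℝ) ^ n := fun n => by
      rw [← one_mul ((-1 / 3 : ℝ) ^ n), ← sum_invSqrtCoeff_mul n, Finset.sum_mul]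
      refine Finset.sum_congr rfl fun p hp => ?_
      rw [← Finset.HasAntidiagonal.mem_antidiagonal.1 hp, pow_add]
      ring
    simp only [this]
    rw [tsum_geometric_of_norm_lt_one (by norm_num)]
    norm_num
  have hpos : 0 < ∑' j, invSqrtCoeff j * (-1 / 3) ^ j := by
    rw [hs.of_norm.tsum_eq_zero_add]
    have hgs : HasSum (fun j : ℕ => ((1 : ℝ) / 3) ^ (j + 1)) (1 / 2) := by
      have := (hasSum_geometric_of_lt_one (r := (1 : ℝ) / 3) (by norm_num)
        (by norm_num)).mul_right (1 / 3)
      simp only [← pow_succ] at this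
      rwa [show (1 - 1 / 3 : ℝ)⁻¹ * (1 / 3) = 1 / 2 by norm_num] at this
    have := tsum_of_norm_bounded hgs fun j => norm_invSqrtCoeff_mul_pow_le (j + 1)
    rw [Real.norm_eq_abs, abs_le] at this
    rw [invSqrtCoeff_zero]
    linarith [this.1]
  have h3 : √3 * √3 = (3 : ℝ) := Real.mul_self_sqrt (by norm_num)
  have : (0 : ℝ) ≤ √3 := Real.sqrt_nonneg _
  nlinarith

theorem trinomial_div_eq_sum (n : ℕ) :
    (trinomial n n : ℝ) / 3 ^ n
      = ∑ j ∈ Finset.range (n + 1), invSqrtCoeff (n - j) * (invSqrtCoeff j * (-1 / 3) ^ j) := by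
  have h := congrArg (PowerSeries.coeff n) trinomialSeries_eq_mul
  rw [mul_comm, PowerSeries.coeff_mul, Finset.Nat.sum_antidiagonal_eq_sum_range_succ_mk,
    trinomialSeries, PowerSeries.coeff_mk] at h
  have h' := congrArg (fun q : ℚ => (q : ℝ)) h
  simp only [invSqrtSeries, PowerSeries.coeff_mk] at h'
  push_cast at h'
  rw [h', Finset.sum_div]
  refine Finset.sum_congr rfl fun j hj => ?_
  have hj' := Finset.mem_range_succ_iff.1 hj
  unfold invSqrtCoeff
  obtain ⟨m, rfl⟩ := Nat.exists_eq_add_of_le hj'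
  rw [Nat.add_sub_cancel_left, pow_add]
  simp only [div_pow]
  field_simp

theorem tendsto_sqrt_mul_trinomial :
    Tendsto (fun n : ℕ => √n * ((trinomial n n : ℝ) / 3 ^ n)) atTop
      (𝓝 (1 / √Real.pi * (√3 / 2))) := by
  -- Extending the finite convolution by zero allows Tannery's theorem to be applied.
  let f : ℕ → ℕ → ℝ := fun n j =>
    if j ≤ n then √n * invSqrtCoeff (n - j) * (invSqrtCoeff j * (-1 / 3) ^ j) else 0
  have hf : ∀ n : ℕ, √n * ((trinomial n n : ℝ) / 3 ^ n) = ∑' j, f n j := fun n => by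
    rw [tsum_eq_sum (s := Finset.range (n + 1)), trinomial_div_eq_sum, Finset.mul_sum]
    · refine Finset.sum_congr rfl fun j hj => ?_
      simp only [f, if_pos (Finset.mem_range_succ_iff.1 hj), mul_assoc]
    · intro j hj
      exact if_neg fun h => hj (Finset.mem_range_succ_iff.2 h)
  simp only [hf]
  rw [← tsum_invSqrtCoeff_mul_pow, ← tsum_mul_left]
  have hbound : Summable fun j : ℕ => ((j : ℝ) + 1) * (1 / 3) ^ j := by
    simp only [add_mul, one_mul]
    refine Summable.add ?_ (summable_geometric_of_lt_one (by norm_num) (by norm_num))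
    simpa using summable_pow_mul_geometric_of_norm_lt_one (R := ℝ) (r := 1 / 3) 1 (by norm_num)
  refine tendsto_tsum_of_dominated_convergence hbound (fun j => ?_) (Eventually.of_forall ?_)
  · refine ((tendsto_sqrt_mul_invSqrtCoeff_sub j).mul_const _).congr' ?_
    filter_upwards [eventually_ge_atTop j] with n hn
    simp only [f, if_pos hn]
  · intro n j
    simp only [f]
    split_ifs with h
    · rw [norm_mul, Real.norm_of_nonneg (mul_nonneg (Real.sqrt_nonneg _) (invSqrtCoeff_nonneg _))]
      exact mul_le_mul (sqrt_mul_invSqrtCoeff_sub_le h) (norm_invSqrtCoeff_mul_pow_le j)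
        (norm_nonneg _) (by positivity)
    · rw [norm_zero]
      positivity

theorem trinomial_isEquivalent :
    (fun n : ℕ => (trinomial n n : ℝ)) ~[atTop]
      (fun n : ℕ => 3 ^ n * (√3 / (2 * √Real.pi * √n))) := by
  have hpi : (0 : ℝ) < √Real.pi := Real.sqrt_pos.2 Real.pi_pos
  have h3 : (0 : ℝ) < √3 := by positivity
  refine (isEquivalent_iff_tendsto_one ?_).2 ?_
  · filter_upwards [eventually_ne_atTop 0] with n hn
    have : (0 : ℝ) < √n := by positivity
    positivity
  · have h := tendsto_sqrt_mul_trinomial.div_const (1 / √Real.pi * (√3 / 2))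
    rw [div_self (by positivity)] at h
    refine h.congr' ?_
    filter_upwards [eventually_ne_atTop 0] with n hn
    have : (0 : ℝ) < √n := by positivity
    simp only [Pi.div_apply]
    field_simp

theorem hasseEdges_isEquivalent :
    (fun n : ℕ => (hasseEdges (GrandMotzkin n) : ℝ)) ~[atTop]
      (fun n : ℕ => 2 * (3 : ℝ) ^ ((n : ℤ) - 2) * √(3 * (n : ℝ) / Real.pi)) := by
  have hpi : (0 : ℝ) < √Real.pi := Real.sqrt_pos.2 Real.pi_pos
  have h3 : (0 : ℝ) < √3 := by positivity
  refine (isEquivalent_iff_tendsto_one ?_).2 ?_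
  · filter_upwards [eventually_ne_atTop 0] with n hn
    have : (0 : ℝ) < n := by positivity
    have := Real.pi_pos
    positivity
  rw [← tendsto_add_atTop_iff_nat 2]
  have hd : Tendsto (fun n : ℕ => (n : ℝ) / (n + 2)) atTop (𝓝 1) :=
    tendsto_natCast_div_add_atTop (2 : ℝ)
  have hd' : Tendsto (fun n : ℕ => ((n + 1 : ℕ) : ℝ) / ((n + 1 : ℕ) + 1)) atTop (𝓝 1) :=
    (tendsto_natCast_div_add_atTop (1 : ℝ)).comp (tendsto_add_atTop_nat 1)
  have hi : Tendsto (fun n : ℕ => ((n : ℝ) + 1) / n) atTop (𝓝 1) := by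
    simpa using (tendsto_natCast_div_add_atTop (1 : ℝ)).inv₀ one_ne_zero
  have ht := tendsto_sqrt_mul_trinomial
  have ht' := ht.comp (tendsto_add_atTop_nat 1)
  -- The terms with t_n and t_{n+1} contribute 1/4 and 3/4 to the limiting ratio.
  have h := (((hi.mul hd.sqrt).mul ht).add ((hd'.sqrt.mul ht').const_mul 3)).mul_const
    (√Real.pi / (2 * √3))
  have hlim : (1 * √1 * (1 / √Real.pi * (√3 / 2)) + 3 * (√1 * (1 / √Real.pi * (√3 / 2))))
      * (√Real.pi / (2 * √3)) = 1 := by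
    rw [Real.sqrt_one]
    field_simp
    norm_num
  rw [hlim] at h
  refine h.congr' ?_
  filter_upwards [eventually_ne_atTop 0] with n hn
  have hn' : (0 : ℝ) < n := by positivity
  have hs₀ : (0 : ℝ) < √n := by positivity
  have hs₁ : (0 : ℝ) < √(n + 1) := by positivity
  have hs₂ : (0 : ℝ) < √(n + 2) := by positivity
  have e₀ : √(n : ℝ) ^ 2 = n := Real.sq_sqrt (by positivity)
  have e₁ : √((n : ℝ) + 1) ^ 2 = n + 1 := Real.sq_sqrt (by positivity)
  have hz : (3 : ℝ) ^ (((n + 2 : ℕ) : ℤ) - 2) = 3 ^ n := by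
    rw [show (((n + 2 : ℕ) : ℤ) - 2) = (n : ℤ) by push_cast; ring, zpow_natCast]
  simp only [Pi.div_apply, Function.comp_apply, hz, GrandMotzkin.hasseEdges_add_two]
  push_cast
  rw [show (n : ℝ) + 1 + 1 = n + 2 by ring, Real.sqrt_div hn'.le, Real.sqrt_div (by positivity),
    Real.sqrt_div (by positivity), Real.sqrt_mul (by norm_num), pow_succ]
  field_simp
  rw [e₀, e₁]
  ring

theorem hasseIndex_isEquivalent :
    (fun n : ℕ => hasseIndex (GrandMotzkin n)) ~[atTop] (fun n : ℕ => 4 / 9 * (n : ℝ)) := by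
  have h := hasseEdges_isEquivalent.div trinomial_isEquivalent
  refine (h.congr_left (Eventually.of_forall fun n => ?_)).congr_right ?_
  · simp only [hasseIndex, GrandMotzkin.card_eq_trinomial, Pi.div_apply]
  · filter_upwards [eventually_ne_atTop 0] with n hn
    have hn' : (0 : ℝ) < n := by positivity
    have hs₀ : (0 : ℝ) < √n := by positivity
    have e₀ : √(n : ℝ) ^ 2 = n := Real.sq_sqrt (by positivity)
    have hpi : (0 : ℝ) < √Real.pi := Real.sqrt_pos.2 Real.pi_pos
    have h3 : (0 : ℝ) < √3 := by positivity
    rw [Pi.div_apply, Real.sqrt_div (by positivity), Real.sqrt_mul (by norm_num),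
      zpow_sub₀ (by norm_num), zpow_natCast]
    norm_num
    field_simp
    rw [e₀]
    ring

theorem asymptoticallyQuasiBoolean_grandMotzkin : AsymptoticallyQuasiBoolean GrandMotzkin := by
  -- Here 1/18 = 1/2 - 4/9.
  refine ⟨1 / 18, by norm_num, by norm_num, Or.inr ?_⟩
  norm_num
  exact hasseIndex_isEquivalent

end Asymptotics

theorem mainTheorem4 :
    -- edge generating series
    (∃ S : PowerSeries ℚ,
      IsFormalSqrt S (1 - 2 * PowerSeries.X - 3 * PowerSeries.X ^ 2) ∧
      edgeSeries GrandMotzkin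
        = 2 * PowerSeries.X ^ 2 * ((1 - 3 * PowerSeries.X) * S)⁻¹) ∧
    -- summation formulas
    (∀ n : ℕ, hasseEdges (GrandMotzkin (n + 2))
      = 2 * ∑ k ∈ Finset.range (n + 1), trinomial k k * 3 ^ (n - k)) ∧
    (∀ n : ℕ, (hasseEdges (GrandMotzkin (n + 2)) : ℚ)
      = 2 / 4 ^ n * ∑ k ∈ Finset.range (n + 1),
          (Nat.choose (2 * k) k : ℚ) * (Nat.choose (2 * n - 2 * k) (n - k) : ℚ)
            * (2 * (k : ℚ) + 1) * 3 ^ k * (-1) ^ (n - k)) ∧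
    (∀ n : ℕ, (hasseEdges (GrandMotzkin (n + 2)) : ℤ)
      = 2 * ∑ k ∈ Finset.range (n + 1),
          (Nat.choose (n + 1) (k + 1) : ℤ) * (Nat.choose (2 * k) k : ℤ)
            * (-1) ^ k * 3 ^ (n - k)) ∧
    -- asymptotic equivalences
    ((fun n : ℕ => (hasseEdges (GrandMotzkin n) : ℝ)) ~[atTop]
      (fun n : ℕ => 2 * (3 : ℝ) ^ ((n : ℤ) - 2) * Real.sqrt (3 * (n : ℝ) / Real.pi))) ∧
    ((fun n : ℕ => hasseIndex (GrandMotzkin n)) ~[atTop]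
      (fun n : ℕ => 4 / 9 * (n : ℝ))) ∧
    AsymptoticallyQuasiBoolean GrandMotzkin := by
  exact ⟨edgeSeries_eq, hasseEdges_eq_sum_trinomial, hasseEdges_eq_convolution,
    hasseEdges_eq_sum_choose, hasseEdges_isEquivalent, hasseIndex_isEquivalent,
    asymptoticallyQuasiBoolean_grandMotzkin⟩
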